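/- All graphs are finite and simple. Let $G$ be a graph and let $B\subseteq V(G)$ be the set of currently blue vertices, the other vertices being white. Let $W_1,\dots,W_r$ be the vertex sets of the connected components of $G-B$. The PSD color change rule says: a vertex $v\in B$ can force a white vertex $w\in W_i$ (that is, change the color of $w$ to blue) if $w$ is the only white neighbor of $v$ in $G[W_i\cup B]$. A nonempty set $S\subseteq V(G)$ is a PSD zero forcing set if, starting with exactly the vertices of $S$ blue, repeated application of this rule colors all vertices blue; $\operatorname{Z}_+(G)$ is the minimum cardinality of a PSD zero forcing set. Put $S^{[0]}=S$ and let $S^{[i+1]}$ be the union of $S^{[i]}$ and the set of all $w$ that can be forced by some $v$ when exactly the vertices of $S^{[i]}$ are blue. Let $\operatorname{pt}_+(G;S)$ be the least $p$ with $S^{[p]}=V(G)$, or $\infty$ if there is none, and let $\operatorname{pt}_+(G,k)=\min_{|S|=k}\operatorname{pt}_+(G;S)$. For a connected graph $G$ of order $n\ge 2$, the PSD product throttling number (with no initial cost) is \[\operatorname{th}_+^\ast(G)=\min_{\operatorname{Z}_+(G)\le k<n} k\,\operatorname{pt}_+(G,k).\] Theorem. Let $G$ be a connected graph of order $n\ge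 2$. Then $\operatorname{th}_+^\ast(G)=n-2$ if and only if the independence number satisfies $\alpha(G)=2$ and $G$ has no induced subgraph isomorphic to the 5-cycle $C_5$ or to the house graph (the graph obtained from a 4-cycle by adding a fifth vertex adjacent to exactly two adjacent vertices of the cycle). -/

import Mathlib

namespace PSDThrottling

/-- `v` can force `w` when `B` is the set of blue vertices: `v` is blue, `w` is white, and `w` is
the only white neighbor of `v` in the connected component of `G - B` that contains `w`. -/
def Forces {V : Type*} (G : SimpleGraph V) (B : Set V) (v w : V) : Prop :=
  v ∈ B ∧ G.Adj v w ∧ ∃ hw : w ∈ Bᶜ, ∀ u : V, ∀ hu : u ∈ Bᶜ,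
    G.Adj v u → (G.induce Bᶜ).Reachable ⟨u, hu⟩ ⟨w, hw⟩ → u = w

/-- `B'` arises from `B` by a single application of the PSD color change rule. -/
def ColorChange {V : Type*} (G : SimpleGraph V) (B B' : Set V) : Prop :=
  ∃ v w : V, Forces G B v w ∧ B' = insert w B

/-- A nonempty set `S` is a PSD zero forcing set if some finite sequence of applications of the
PSD color change rule, starting with exactly the vertices of `S` blue, colors all vertices blue. -/
def IsForcingSet {V : Type*} (G : SimpleGraph V) (S : Set V) : Prop :=
  S.Nonempty ∧ Relation.ReflTransGen (ColorChange G) S Set.univ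

/-- The PSD zero forcing number `Z₊(G)`. -/
noncomputable def forcingNumber {V : Type*} (G : SimpleGraph V) : ℕ :=
  sInf {k : ℕ | ∃ S : Finset V, IsForcingSet G (S : Set V) ∧ S.card = k}

/-- The set of vertices that are blue after round `i`, starting with `S` blue; in each round all
possible forces are performed simultaneously. -/
def blue {V : Type*} (G : SimpleGraph V) (S : Set V) : ℕ → Set V
  | 0 => S
  | i + 1 => blue G S i ∪ {w | ∃ v, Forces G (blue G S i) v w}

/-- The PSD propagation time `pt₊(G; S)`: the least number of rounds after which all vertices are
blue, and `⊤` if this never happens. -/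
noncomputable def propTime {V : Type*} (G : SimpleGraph V) (S : Set V) : ℕ∞ :=
  ⨅ (p : ℕ) (_ : blue G S p = Set.univ), (p : ℕ∞)

/-- `pt₊(G, k)`: the minimum of `pt₊(G; S)` over all `k`-element sets `S` of vertices. -/
noncomputable def propTimeCard {V : Type*} (G : SimpleGraph V) (k : ℕ) : ℕ∞ :=
  ⨅ (S : Finset V) (_ : S.card = k), propTime G (S : Set V)

/-- The PSD product throttling number with no initial cost,
`th₊*(G) = min {k * pt₊(G, k) : Z₊(G) ≤ k < n}`, where `n` is the order of `G`. -/
noncomputable def productThrottling {V : Type*} [Fintype V] (G : SimpleGraph V) : ℕ∞ :=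
  ⨅ (k : ℕ) (_ : forcingNumber G ≤ k ∧ k < Fintype.card V), (k : ℕ∞) * propTimeCard G k

/-- The house graph: the 4-cycle `0, 1, 2, 3` with a roof vertex `4` adjacent to `2` and `3`. -/
def houseGraph : SimpleGraph (Fin 5) :=
  SimpleGraph.fromEdgeSet {s(0, 1), s(1, 2), s(2, 3), s(3, 0), s(4, 2), s(4, 3)}

end PSDThrottling

namespace PSDThrottling

variable {V : Type*} {G : SimpleGraph V}

/-- `u` and `v` are white and lie in the same connected component of `G - B`. -/
def WhiteReachable (G : SimpleGraph V) (B : Set V) (u v : V) : Prop :=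
  ∃ (hu : u ∈ Bᶜ) (hv : v ∈ Bᶜ), (G.induce Bᶜ).Reachable ⟨u, hu⟩ ⟨v, hv⟩

theorem WhiteReachable.refl {B : Set V} {u : V} (hu : u ∉ B) : WhiteReachable G B u u :=
  ⟨hu, hu, SimpleGraph.Reachable.refl _⟩

theorem WhiteReachable.symm {B : Set V} {u v : V} (h : WhiteReachable G B u v) :
    WhiteReachable G B v u :=
  let ⟨hu, hv, hr⟩ := h
  ⟨hv, hu, hr.symm⟩

theorem WhiteReachable.trans {B : Set V} {u v w : V} (h : WhiteReachable G B u v)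
    (h' : WhiteReachable G B v w) : WhiteReachable G B u w :=
  let ⟨hu, _, hr⟩ := h
  let ⟨_, hw, hr'⟩ := h'
  ⟨hu, hw, hr.trans hr'⟩

theorem WhiteReachable.of_adj {B : Set V} {u v : V} (hu : u ∉ B) (hv : v ∉ B) (h : G.Adj u v) :
    WhiteReachable G B u v :=
  ⟨hu, hv, SimpleGraph.Adj.reachable (by simpa using h)⟩

theorem WhiteReachable.anti {B B' : Set V} (hB : B ⊆ B') {u v : V}
    (h : WhiteReachable G B' u v) : WhiteReachable G B u v := by
  obtain ⟨hu, hv, hr⟩ := h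
  have hsub : B'ᶜ ⊆ Bᶜ := Set.compl_subset_compl.2 hB
  exact ⟨hsub hu, hsub hv, hr.map (SimpleGraph.induceHomOfLE G hsub).toHom⟩

theorem Forces.not_mem {B : Set V} {v w : V} (h : Forces G B v w) : w ∉ B := h.2.2.1

theorem Forces.adj {B : Set V} {v w : V} (h : Forces G B v w) : G.Adj v w := h.2.1

theorem Forces.eq_of_adj {B : Set V} {v w u : V} (h : Forces G B v w) (hu : G.Adj v u)
    (hr : WhiteReachable G B u w) : u = w :=
  h.2.2.2 u hr.1 hu hr.2.2

theorem Forces.not_adj {B : Set V} {v w u : V} (h : Forces G B v w) (hne : u ≠ w)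
    (hr : WhiteReachable G B u w) : ¬ G.Adj v u :=
  fun hu => hne (h.eq_of_adj hu hr)

theorem forces_of_forall {B : Set V} {v w : V} (hv : v ∈ B) (hw : w ∉ B) (ha : G.Adj v w)
    (h : ∀ u, G.Adj v u → WhiteReachable G B u w → u = w) : Forces G B v w :=
  ⟨hv, ha, hw, fun u hu hvu hr => h u hvu ⟨hu, hw, hr⟩⟩

theorem Forces.mono {B B' : Set V} (hB : B ⊆ B') {v w : V} (h : Forces G B v w) (hw : w ∉ B') :
    Forces G B' v w :=
  forces_of_forall (hB h.1) hw h.adj fun _ hu hr => h.eq_of_adj hu (hr.anti hB)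

/-- A set of white vertices with no edges to the other white vertices is a union of components. -/
theorem WhiteReachable.mem_of_closed {B K : Set V}
    (hK : ∀ u ∈ K, ∀ v, v ∉ B → G.Adj u v → v ∈ K) {u v : V} (h : WhiteReachable G B u v)
    (hu : u ∈ K) : v ∈ K := by
  obtain ⟨hu', hv', ⟨p⟩⟩ := h
  have key : ∀ x y : (Bᶜ : Set V), (G.induce Bᶜ).Walk x y → (x : V) ∈ K → (y : V) ∈ K := by
    intro x y q
    induction q with
    | nil => exact id
    | @cons _ b _ ha _ ih => exact fun hx => ih (hK _ hx b b.2 (by simpa using ha))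
  exact key _ _ p hu

theorem forces_of_closed {B K : Set V} (hK : ∀ u ∈ K, ∀ v, v ∉ B → G.Adj u v → v ∈ K) {v w : V}
    (hv : v ∈ B) (hw : w ∉ B) (hwK : w ∈ K) (ha : G.Adj v w)
    (h : ∀ u ∈ K, u ∉ B → G.Adj v u → u = w) : Forces G B v w :=
  forces_of_forall hv hw ha fun u hu hr =>
    h u (hr.symm.mem_of_closed hK hwK) hr.1 hu

theorem reflTransGen_colorChange_union {B : Set V} (W : Set V) (hfin : W.Finite)
    (hW : ∀ w ∈ W, ∃ v, Forces G B v w) : Relation.ReflTransGen (ColorChange G) B (B ∪ W) := by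
  induction W, hfin using Set.Finite.induction_on with
  | empty => simpa using Relation.ReflTransGen.refl
  | @insert a s ha _ ih =>
    refine (ih fun w hw => hW w (Set.mem_insert_of_mem _ hw)).tail ?_
    obtain ⟨v, hv⟩ := hW a (Set.mem_insert _ _)
    refine ⟨v, a, hv.mono Set.subset_union_left ?_, Set.union_insert⟩
    rintro (h | h)
    exacts [hv.not_mem h, ha h]

theorem propTime_le {S : Set V} {p : ℕ} (h : blue G S p = Set.univ) : propTime G S ≤ p :=
  iInf₂_le p h

/-- If all white vertices can be forced in the first round, then the initial cardinality bounds the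
throttling number. -/
theorem productThrottling_le_of_forces [Fintype V] {S : Finset V} (hS : S.Nonempty) (hne : ∃ x, x ∉ S)
    (h : ∀ w ∉ S, ∃ v, Forces G (S : Set V) v w) : productThrottling G ≤ (S.card : ℕ∞) := by
  have hlt : S.card < Fintype.card V :=
    Finset.card_lt_univ_of_notMem hne.choose_spec
  have hforce : IsForcingSet G (S : Set V) := by
    refine ⟨by simpa using hS, ?_⟩
    have := reflTransGen_colorChange_union (G := G) (B := (S : Set V)) (S : Set V)ᶜ
      (Set.toFinite _) (fun w hw => h w (by simpa using hw))
    simpa using this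
  have hZ : forcingNumber G ≤ S.card := Nat.sInf_le ⟨S, hforce, rfl⟩
  have hp : propTime G (S : Set V) ≤ (1 : ℕ) := by
    refine propTime_le (Set.eq_univ_of_forall fun w => ?_)
    by_cases hw : w ∈ S
    · exact Or.inl (by simpa [blue] using hw)
    · exact Or.inr (h w hw)
  calc productThrottling G ≤ (S.card : ℕ∞) * propTimeCard G S.card := iInf₂_le S.card ⟨hZ, hlt⟩
    _ ≤ (S.card : ℕ∞) * (1 : ℕ) := by
        gcongr
        exact iInf₂_le_of_le S rfl hp
    _ = S.card := by simp

theorem one_le_forcingNumber [Fintype V] : 1 ≤ forcingNumber G ∨ IsEmpty V := by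
  rcases isEmpty_or_nonempty V with hV | hV
  · exact Or.inr hV
  · left
    have hne : {k : ℕ | ∃ S : Finset V, IsForcingSet G (S : Set V) ∧ S.card = k}.Nonempty :=
      ⟨_, Finset.univ, ⟨by simp, by simpa using Relation.ReflTransGen.refl⟩, rfl⟩
    obtain ⟨S, hS, hcard⟩ := Nat.sInf_mem hne
    change S.card = forcingNumber G at hcard
    rw [← hcard, Nat.one_le_iff_ne_zero, Finset.card_ne_zero]
    simpa using hS.1

theorem exists_propTimeCard_eq {k : ℕ} (h : propTimeCard G k ≠ ⊤) :
    ∃ (S : Finset V) (p : ℕ), S.card = k ∧ blue G (S : Set V) p = Set.univ ∧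
      propTimeCard G k = p := by
  by_contra hcon
  push Not at hcon
  have hlt : ∀ n : ℕ, (n : ℕ∞) ≤ propTimeCard G k := by
    intro n
    induction n with
    | zero => simp
    | succ n ih =>
      refine le_iInf₂ fun S hS => le_iInf₂ fun p hp => ?_
      have h1 : propTimeCard G k ≤ p := (iInf₂_le S hS).trans (propTime_le hp)
      have h2 := lt_of_le_of_ne h1 (hcon S p hS hp)
      exact_mod_cast Order.add_one_le_of_lt (ih.trans_lt h2)
  exact h (ENat.eq_top_iff_forall_ge.2 hlt)

theorem le_productThrottling [Fintype V] [Nonempty V] {m : ℕ}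
    (h : ∀ (S : Finset V) (p : ℕ), S.Nonempty → S.card < Fintype.card V →
      blue G (S : Set V) p = Set.univ → m ≤ S.card * p) : (m : ℕ∞) ≤ productThrottling G := by
  refine le_iInf₂ fun k hk => ?_
  have hk1 : 1 ≤ k := (one_le_forcingNumber.resolve_right (not_isEmpty_of_nonempty V)).trans hk.1
  by_cases htop : propTimeCard G k = ⊤
  · rw [htop, ENat.mul_top (by exact_mod_cast (by omega : k ≠ 0))]
    exact le_top
  · obtain ⟨S, p, rfl, hp, heq⟩ := exists_propTimeCard_eq htop
    rw [heq]
    exact_mod_cast h S p (Finset.card_pos.1 hk1) hk.2 hp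

theorem ncard_blue_le {c : ℕ} (hc : ∀ B : Set V, {w | ∃ v, Forces G B v w}.ncard ≤ c) (S : Set V)
    (p : ℕ) : (blue G S p).ncard ≤ S.ncard + c * p := by
  induction p with
  | zero => simp [blue]
  | succ p ih =>
    calc (blue G S (p + 1)).ncard ≤ (blue G S p).ncard + {w | ∃ v, Forces G (blue G S p) v w}.ncard :=
          Set.ncard_union_le _ _
      _ ≤ S.ncard + c * p + c := add_le_add ih (hc _)
      _ = _ := by ring

theorem card_le_of_blue_eq_univ [Fintype V] {c : ℕ} (hc : ∀ B : Set V, {w | ∃ v, Forces G B v w}.ncard ≤ c)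
    {S : Finset V} {p : ℕ} (hp : blue G (S : Set V) p = Set.univ) :
    Fintype.card V ≤ S.card + c * p := by
  have := ncard_blue_le hc (S : Set V) p
  rwa [hp, Set.ncard_univ, Nat.card_eq_fintype_card, Set.ncard_coe_finset] at this

theorem pos_of_blue_eq_univ [Fintype V] {S : Finset V} {p : ℕ} (hlt : S.card < Fintype.card V)
    (hp : blue G (S : Set V) p = Set.univ) : 1 ≤ p := by
  rcases Nat.eq_zero_or_pos p with rfl | h
  · have : S = Finset.univ := by simpa [blue] using hp
    simp [this] at hlt
  · exact h

/-- Every connected component of `G - B` has at most one blue neighbor. -/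
def UniqueAttachment (G : SimpleGraph V) (B : Set V) : Prop :=
  ∀ u u' v v' : V, WhiteReachable G B u u' → v ∈ B → v' ∈ B → G.Adj v u → G.Adj v' u' → v = v'

theorem UniqueAttachment.eq_of_forces {B : Set V} (h : UniqueAttachment G B) {x x' w w' : V}
    (hw : Forces G B x w) (hw' : Forces G B x' w') (hr : WhiteReachable G B w w') : w = w' := by
  obtain rfl := h w w' x x' hr hw.1 hw'.1 hw.adj hw'.adj
  exact hw'.eq_of_adj hw.adj hr

theorem uniqueAttachment_blue (s : V) (i : ℕ) : UniqueAttachment G (blue G {s} i) := by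
  induction i with
  | zero =>
    intro u u' v v' _ hv hv' _ _
    rw [Set.mem_singleton_iff.1 hv, Set.mem_singleton_iff.1 hv']
  | succ i ih =>
    have mixed : ∀ {u u' v v' : V}, WhiteReachable G (blue G {s} (i + 1)) u u' →
        v ∈ blue G {s} i → (∃ x, Forces G (blue G {s} i) x v') → G.Adj v u → G.Adj v' u' →
        False := by
      rintro u u' v v' hr hv ⟨x, hx⟩ hu hu'
      have hr' := hr.anti (B := blue G {s} i) Set.subset_union_left
      have hr'' : WhiteReachable G (blue G {s} i) u v' :=
        hr'.trans (.of_adj hr'.2.1 hx.not_mem hu'.symm)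
      obtain rfl := ih u v' v x hr'' hv hx.1 hu hx.adj
      obtain rfl := hx.eq_of_adj hu hr''
      exact hr.1 (Or.inr ⟨v, hx⟩)
    intro u u' v v' hr hv hv' hu hu'
    have hr' := hr.anti (B := blue G {s} i) Set.subset_union_left
    rcases hv with hv | hv <;> rcases hv' with hv' | hv'
    · exact ih u u' v v' hr' hv hv' hu hu'
    · exact (mixed hr hv hv' hu hu').elim
    · exact (mixed hr.symm hv' hv hu' hu).elim
    · obtain ⟨x, hx⟩ := hv
      obtain ⟨x', hx'⟩ := hv'
      exact ih.eq_of_forces hx hx' ((WhiteReachable.of_adj hx.not_mem hr'.1 hu).trans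
        (hr'.trans (.of_adj hr'.2.1 hx'.not_mem hu'.symm)))

/-- While at most one vertex of a triangle is blue, this persists. -/
theorem triangle_white_blue {s : V} {a b c : V} (hab : G.Adj a b) (hac : G.Adj a c)
    (hbc : G.Adj b c) (i : ℕ) :
    (a ∉ blue G {s} i ∧ b ∉ blue G {s} i) ∨ (a ∉ blue G {s} i ∧ c ∉ blue G {s} i) ∨
      (b ∉ blue G {s} i ∧ c ∉ blue G {s} i) := by
  induction i with
  | zero =>
    have h1 := hab.ne
    have h2 := hac.ne
    have h3 := hbc.ne
    simp only [blue, Set.mem_singleton_iff]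
    grind
  | succ i ih =>
    have hU := uniqueAttachment_blue (G := G) s i
    set B := blue G {s} i with hB
    have step : ∀ {x y z : V}, G.Adj x y → G.Adj x z → G.Adj y z → x ∉ B → y ∉ B →
        (x ∉ blue G {s} (i + 1) ∧ y ∉ blue G {s} (i + 1)) ∨
        (x ∉ blue G {s} (i + 1) ∧ z ∉ blue G {s} (i + 1)) ∨
        (y ∉ blue G {s} (i + 1) ∧ z ∉ blue G {s} (i + 1)) := by
      intro x y z hxy hxz hyz hx hy
      have hmem : ∀ t, t ∈ blue G {s} (i + 1) ↔ t ∈ B ∨ ∃ v, Forces G B v t := fun _ => Iff.rfl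
      have hrxy := WhiteReachable.of_adj hx hy hxy
      have hpair : ∀ {p q : V}, G.Adj p q → (∃ v, Forces G B v p) → (∃ v, Forces G B v q) →
          False := by
        rintro p q hpq ⟨v, hv⟩ ⟨v', hv'⟩
        exact hpq.ne (hU.eq_of_forces hv hv' (.of_adj hv.not_mem hv'.not_mem hpq))
      have hz : z ∈ B → ∀ v, ¬ Forces G B v x ∧ ¬ Forces G B v y := by
        intro hz v
        constructor
        · intro hv
          obtain rfl := hU x x v z (.refl hx) hv.1 hz hv.adj hxz.symm
          exact hxy.ne' (hv.eq_of_adj hyz.symm hrxy.symm)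
        · intro hv
          obtain rfl := hU y y v z (.refl hy) hv.1 hz hv.adj hyz.symm
          exact hxy.ne (hv.eq_of_adj hxz.symm hrxy)
      have h1 := hpair hxy
      have h2 := hpair hxz
      have h3 := hpair hyz
      simp only [hmem]
      by_cases hzB : z ∈ B
      · have := hz hzB
        grind
      · grind
    rcases ih with ⟨h1, h2⟩ | ⟨h1, h2⟩ | ⟨h1, h2⟩
    · exact step hab hac hbc h1 h2
    · have := step hac hab hbc.symm h1 h2
      tauto
    · have := step hbc hab.symm hac.symm h1 h2
      tauto

theorem not_triangle_of_blue_singleton {s : V} {p : ℕ} (hp : blue G {s} p = Set.univ) {a b c : V}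
    (hab : G.Adj a b) (hac : G.Adj a c) (hbc : G.Adj b c) : False := by
  simpa [hp] using triangle_white_blue (s := s) hab hac hbc p

theorem isIndContained_of_adj_iff {ι : Type*} {H : SimpleGraph ι} (f : ι → V)
    (hf : ∀ i j, G.Adj (f i) (f j) ↔ H.Adj i j)
    (hH : ∀ i j, (∀ k, H.Adj i k ↔ H.Adj j k) → i = j) : H.IsIndContained G :=
  ⟨⟨⟨f, fun i j hij => hH i j fun k => by rw [← hf, ← hf, hij]⟩, hf _ _⟩⟩

theorem cycleGraph_five_isIndContained {a b c d e : V} (hab : G.Adj a b) (hbc : G.Adj b c)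
    (hcd : G.Adj c d) (hde : G.Adj d e) (hea : G.Adj e a) (hac : ¬ G.Adj a c) (had : ¬ G.Adj a d)
    (hbd : ¬ G.Adj b d) (hbe : ¬ G.Adj b e) (hce : ¬ G.Adj c e) :
    (SimpleGraph.cycleGraph 5).IsIndContained G := by
  refine isIndContained_of_adj_iff ![a, b, c, d, e] (fun i j => ?_) (by decide)
  fin_cases i <;> fin_cases j <;>
    simp [SimpleGraph.cycleGraph_adj, hab, hbc, hcd, hde, hea, hac, had, hbd, hbe, hce,
      G.adj_comm b a, G.adj_comm c a, G.adj_comm d a, G.adj_comm a e, G.adj_comm c b,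
      G.adj_comm d b, G.adj_comm e b, G.adj_comm d c, G.adj_comm e c, G.adj_comm e d] <;> decide

theorem houseGraph_adj_iff (i j : Fin 5) :
    houseGraph.Adj i j ↔ s(i, j) ∈ ({s(0, 1), s(1, 2), s(2, 3), s(3, 0), s(4, 2), s(4, 3)} :
      Finset (Sym2 (Fin 5))) := by
  revert i j
  simp only [houseGraph, SimpleGraph.fromEdgeSet_adj, Set.mem_insert_iff, Set.mem_singleton_iff]
  decide

theorem houseGraph_isIndContained {a b c d e : V} (hab : G.Adj a b) (hbc : G.Adj b c)
    (hcd : G.Adj c d) (hda : G.Adj d a) (hec : G.Adj e c) (hed : G.Adj e d) (hac : ¬ G.Adj a c)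
    (hbd : ¬ G.Adj b d) (hae : ¬ G.Adj a e) (hbe : ¬ G.Adj b e) :
    houseGraph.IsIndContained G := by
  refine isIndContained_of_adj_iff ![a, b, c, d, e] (fun i j => ?_)
    (by simp only [houseGraph_adj_iff]; decide)
  rw [houseGraph_adj_iff]
  fin_cases i <;> fin_cases j <;>
    simp [hab, hbc, hcd, hda, hec, hed, hac, hbd, hae, hbe,
      G.adj_comm b a, G.adj_comm c a, G.adj_comm a d, G.adj_comm e a, G.adj_comm c b,
      G.adj_comm d b, G.adj_comm e b, G.adj_comm d c, G.adj_comm c e, G.adj_comm d e]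

/-- Vertices `x`, `y`, `z` such that `x` is isolated among them and each of them can be forced from
outside give an upper bound on the throttling number. -/
theorem productThrottling_le_card_sub_three [Fintype V] {x y z : V} (hxy : x ≠ y) (hxz : x ≠ z)
    (hyz : y ≠ z) (nxy : ¬ G.Adj x y) (nxz : ¬ G.Adj x z)
    (hx : ∃ v, v ≠ y ∧ v ≠ z ∧ G.Adj v x)
    (hy : ∃ v, v ≠ x ∧ v ≠ z ∧ G.Adj v y ∧ (G.Adj v z → ¬ G.Adj y z))
    (hz : ∃ v, v ≠ x ∧ v ≠ y ∧ G.Adj v z ∧ (G.Adj v y → ¬ G.Adj y z)) :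
    productThrottling G + 3 ≤ Fintype.card V := by
  classical
  have hcard : ({x, y, z} : Finset V).card = 3 :=
    Finset.card_eq_three.2 ⟨x, y, z, hxy, hxz, hyz, rfl⟩
  have hmem : ∀ w, w ∉ ({x, y, z} : Finset V)ᶜ ↔ w = x ∨ w = y ∨ w = z :=
    fun w => by simp; tauto
  have hmem' : ∀ w, w ∉ ((({x, y, z} : Finset V)ᶜ : Finset V) : Set V) ↔ w = x ∨ w = y ∨ w = z :=
    fun w => by simp; tauto
  have hmem'' : ∀ w, w ≠ x → w ≠ y → w ≠ z → w ∈ ((({x, y, z} : Finset V)ᶜ : Finset V) : Set V) :=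
    fun w => by simp; tauto
  have hle : productThrottling G ≤ (({x, y, z} : Finset V)ᶜ.card : ℕ∞) := by
    refine productThrottling_le_of_forces ?_ ?_ ?_
    · obtain ⟨v, hvy, hvz, hvx⟩ := hx
      exact ⟨v, by simp [hvy, hvz, hvx.ne]⟩
    · exact ⟨x, by simp⟩
    · intro w hw
      rcases (hmem w).1 hw with rfl | rfl | rfl
      · obtain ⟨v, hvy, hvz, hvx⟩ := hx
        refine ⟨v, forces_of_closed (K := {w}) ?_ (hmem'' v hvx.ne hvy hvz) ((hmem' w).2 (by simp))
          rfl hvx fun u hu _ _ => hu⟩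
        rintro u rfl t ht hut
        rcases (hmem' t).1 ht with rfl | rfl | rfl
        exacts [rfl, (nxy hut).elim, (nxz hut).elim]
      · obtain ⟨v, hvx, hvz, hvy, hv⟩ := hy
        refine ⟨v, forces_of_closed (K := {u | u = w ∨ u = z ∧ G.Adj w z}) ?_
          (hmem'' v hvx hvy.ne hvz) ((hmem' w).2 (by simp)) (Or.inl rfl) hvy ?_⟩
        · rintro u hu t ht hut
          have := (hmem' t).1 ht
          simp only [Set.mem_ofPred_eq] at hu ⊢
          grind [G.adj_comm]
        · rintro u (rfl | ⟨rfl, h⟩) _ hvu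
          exacts [rfl, (hv hvu h).elim]
      · obtain ⟨v, hvx, hvy, hvz, hv⟩ := hz
        refine ⟨v, forces_of_closed (K := {u | u = w ∨ u = y ∧ G.Adj y w}) ?_
          (hmem'' v hvx hvy hvz.ne) ((hmem' w).2 (by simp)) (Or.inl rfl) hvz ?_⟩
        · rintro u hu t ht hut
          have := (hmem' t).1 ht
          simp only [Set.mem_ofPred_eq] at hu ⊢
          grind [G.adj_comm]
        · rintro u (rfl | ⟨rfl, h⟩) _ hvu
          exacts [rfl, (hv hvu h).elim]
  calc productThrottling G + 3 ≤ (({x, y, z} : Finset V)ᶜ.card : ℕ∞) + 3 := by gcongr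
    _ = Fintype.card V := by
      have := Finset.card_compl_add_card ({x, y, z} : Finset V)
      rw [hcard] at this
      exact_mod_cast this

theorem productThrottling_le_card_sub_two [Fintype V] {x y : V} (hxy : x ≠ y) (nxy : ¬ G.Adj x y)
    (hx : ∃ v, G.Adj v x) (hy : ∃ v, G.Adj v y) :
    productThrottling G ≤ ((Fintype.card V - 2 : ℕ) : ℕ∞) := by
  classical
  have hcard : ({x, y} : Finset V)ᶜ.card = Fintype.card V - 2 := by
    rw [Finset.card_compl, Finset.card_pair hxy]
  have hmem : ∀ w, w ∉ ((({x, y} : Finset V)ᶜ : Finset V) : Set V) ↔ w = x ∨ w = y :=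
    fun w => by simp; tauto
  obtain ⟨v, hv⟩ := hx
  obtain ⟨v', hv'⟩ := hy
  have hvy : v ≠ y := by rintro rfl; exact nxy hv.symm
  have hvx : v' ≠ x := by rintro rfl; exact nxy hv'
  rw [← hcard]
  refine productThrottling_le_of_forces ⟨v, by simp [hvy, hv.ne]⟩
    ⟨x, by simp⟩ fun w hw => ?_
  have hclosed : ∀ u ∈ ({w} : Set V), ∀ t,
      t ∉ ((({x, y} : Finset V)ᶜ : Finset V) : Set V) → G.Adj u t → t ∈ ({w} : Set V) := by
    rintro u rfl t ht hut
    rcases (hmem u).1 hw with rfl | rfl <;> rcases (hmem t).1 ht with rfl | rfl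
    exacts [rfl, (nxy hut).elim, (nxy hut.symm).elim, rfl]
  rcases (hmem w).1 hw with rfl | rfl
  · exact ⟨v, forces_of_closed hclosed (by simp [hvy, hv.ne]) hw rfl hv fun u hu _ _ => hu⟩
  · exact ⟨v', forces_of_closed hclosed (by simp [hvx, hv'.ne]) hw rfl hv' fun u hu _ _ => hu⟩

theorem productThrottling_add_three_le_of_cycleGraph_five [Fintype V]
    (h : (SimpleGraph.cycleGraph 5).IsIndContained G) :
    productThrottling G + 3 ≤ Fintype.card V := by
  obtain ⟨f⟩ := h
  have hadj : ∀ i j, G.Adj (f i) (f j) ↔ (SimpleGraph.cycleGraph 5).Adj i j :=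
    fun i j => f.map_adj_iff
  have hne : ∀ i j, f i ≠ f j ↔ i ≠ j := fun i j => f.injective.ne_iff
  refine productThrottling_le_card_sub_three (x := f 1) (y := f 3) (z := f 4) ?_ ?_ ?_ ?_ ?_
    ⟨f 0, ?_⟩ ⟨f 2, ?_⟩ ⟨f 0, ?_⟩ <;> simp only [hadj, hne] <;> decide

theorem productThrottling_add_three_le_of_houseGraph [Fintype V]
    (h : houseGraph.IsIndContained G) : productThrottling G + 3 ≤ Fintype.card V := by
  obtain ⟨f⟩ := h
  have hadj : ∀ i j, G.Adj (f i) (f j) ↔ houseGraph.Adj i j := fun i j => f.map_adj_iff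
  have hne : ∀ i j, f i ≠ f j ↔ i ≠ j := fun i j => f.injective.ne_iff
  refine productThrottling_le_card_sub_three (x := f 4) (y := f 0) (z := f 1) ?_ ?_ ?_ ?_ ?_
    ⟨f 2, ?_⟩ ⟨f 3, ?_⟩ ⟨f 2, ?_⟩ <;> simp only [hadj, hne, houseGraph_adj_iff] <;> decide

theorem productThrottling_add_three_le_of_indep [Fintype V] (hG : G.Preconnected) {x y z : V}
    (hxy : x ≠ y) (hxz : x ≠ z) (hyz : y ≠ z) (nxy : ¬ G.Adj x y) (nxz : ¬ G.Adj x z)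
    (nyz : ¬ G.Adj y z) : productThrottling G + 3 ≤ Fintype.card V := by
  have : Nontrivial V := ⟨x, y, hxy⟩
  obtain ⟨a, ha⟩ := hG.exists_adj_of_nontrivial x
  obtain ⟨b, hb⟩ := hG.exists_adj_of_nontrivial y
  obtain ⟨c, hc⟩ := hG.exists_adj_of_nontrivial z
  refine productThrottling_le_card_sub_three hxy hxz hyz nxy nxz ⟨a, ?_, ?_, ha.symm⟩
    ⟨b, ?_, ?_, hb.symm, fun _ => nyz⟩ ⟨c, ?_, ?_, hc.symm, fun _ => nyz⟩ <;> grind [G.adj_comm]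

/-- In a graph without independent triples, two vertices of one component cannot be forced
simultaneously while there is another component, unless there is an induced 5-cycle or house. -/
theorem not_forces_pair_of_not_whiteReachable
    (hα : ∀ x y z, x ≠ y → x ≠ z → y ≠ z → G.Adj x y ∨ G.Adj x z ∨ G.Adj y z)
    (hC : ¬ (SimpleGraph.cycleGraph 5).IsIndContained G) (hH : ¬ houseGraph.IsIndContained G)
    {B : Set V} {a b c x y : V} (hab : a ≠ b) (ha : Forces G B x a) (hb : Forces G B y b)
    (hr : WhiteReachable G B a b) (hc : c ∉ B) (hac : ¬ WhiteReachable G B a c) : False := by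
  have hbc : ¬ WhiteReachable G B b c := fun h => hac (hr.trans h)
  have nac : ¬ G.Adj a c := fun h => hac (.of_adj ha.not_mem hc h)
  have nbc : ¬ G.Adj b c := fun h => hbc (.of_adj hb.not_mem hc h)
  have hac' : a ≠ c := by rintro rfl; exact hac (.refl hc)
  have hbc' : b ≠ c := by rintro rfl; exact hbc (.refl hc)
  have nxb := ha.not_adj hab.symm hr.symm
  have nya := hb.not_adj hab hr
  have ne : ∀ {p q}, p ∈ B → q ∉ B → p ≠ q := fun hp hq h => hq (h ▸ hp)
  have eab : G.Adj a b := by have := hα a b c hab hac' hbc'; tauto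
  have exc : G.Adj x c := by
    have := hα x b c (ne ha.1 hb.not_mem) (ne ha.1 hc) hbc'; tauto
  have eyc : G.Adj y c := by
    have := hα y a c (ne hb.1 ha.not_mem) (ne hb.1 hc) hac'; tauto
  by_cases hxy : G.Adj x y
  · exact hH (houseGraph_isIndContained eab hb.adj.symm hxy.symm ha.adj eyc.symm exc.symm
      (fun h => nya h.symm) (fun h => nxb h.symm) nac nbc)
  · exact hC (cycleGraph_five_isIndContained eab hb.adj.symm eyc exc.symm ha.adj
      (fun h => nya h.symm) nac nbc (fun h => nxb h.symm) (fun h => hxy h.symm))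

/-- In a graph without independent triples and induced houses, no three vertices of one component
can be forced simultaneously. -/
theorem not_forces_triple_of_whiteReachable
    (hα : ∀ x y z, x ≠ y → x ≠ z → y ≠ z → G.Adj x y ∨ G.Adj x z ∨ G.Adj y z)
    (hH : ¬ houseGraph.IsIndContained G)
    {B : Set V} {a b c x y z : V} (hab : a ≠ b) (hac : a ≠ c) (hbc : b ≠ c) (ha : Forces G B x a)
    (hb : Forces G B y b) (hc : Forces G B z c) (rab : WhiteReachable G B a b)
    (rac : WhiteReachable G B a c) : False := by
  have rbc := rab.symm.trans rac
  have nxb := ha.not_adj hab.symm rab.symm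
  have nxc := ha.not_adj hac.symm rac.symm
  have nya := hb.not_adj hab rab
  have nyc := hb.not_adj hbc.symm rbc.symm
  have nza := hc.not_adj hac rac
  have nzb := hc.not_adj hbc rbc
  have ne : ∀ {p q}, p ∈ B → q ∉ B → p ≠ q := fun hp hq h => hq (h ▸ hp)
  have ebc : G.Adj b c := by
    have := hα x b c (ne ha.1 hb.not_mem) (ne ha.1 hc.not_mem) hbc; tauto
  have eac : G.Adj a c := by
    have := hα y a c (ne hb.1 ha.not_mem) (ne hb.1 hc.not_mem) hac; tauto
  have eab : G.Adj a b := by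
    have := hα z a b (ne hc.1 ha.not_mem) (ne hc.1 hb.not_mem) hab; tauto
  have hxy' : x ≠ y := by rintro rfl; exact nya ha.adj
  have exy : G.Adj x y := by
    have := hα x y c hxy' (ne ha.1 hc.not_mem) (ne hb.1 hc.not_mem); tauto
  exact hH (houseGraph_isIndContained exy.symm ha.adj eab hb.adj.symm eac.symm ebc.symm
    nya nxb nyc nxc)

theorem ncard_forced_le_two [Finite V]
    (hα : ∀ x y z, x ≠ y → x ≠ z → y ≠ z → G.Adj x y ∨ G.Adj x z ∨ G.Adj y z)
    (hC : ¬ (SimpleGraph.cycleGraph 5).IsIndContained G) (hH : ¬ houseGraph.IsIndContained G)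
    (B : Set V) : {w | ∃ v, Forces G B v w}.ncard ≤ 2 := by
  by_contra! h
  obtain ⟨a, b, c, ⟨x, hx⟩, ⟨y, hy⟩, ⟨z, hz⟩, hab, hac, hbc⟩ := (Set.two_lt_ncard_iff).1 h
  have na := hx.not_mem
  have nb := hy.not_mem
  have nc := hz.not_mem
  by_cases rab : WhiteReachable G B a b
  · by_cases rac : WhiteReachable G B a c
    · exact not_forces_triple_of_whiteReachable hα hH hab hac hbc hx hy hz rab rac
    · exact not_forces_pair_of_not_whiteReachable hα hC hH hab hx hy rab nc rac
  · by_cases rac : WhiteReachable G B a c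
    · exact not_forces_pair_of_not_whiteReachable hα hC hH hac hx hz rac nb rab
    · by_cases rbc : WhiteReachable G B b c
      · exact not_forces_pair_of_not_whiteReachable hα hC hH hbc hy hz rbc na
          fun h => rab h.symm
      · rcases hα a b c hab hac hbc with h | h | h
        exacts [rab (.of_adj na nb h), rac (.of_adj na nc h), rbc (.of_adj nb nc h)]

/-- A triangle-free graph without independent triples and induced 5-cycles has at most four
vertices. -/
theorem card_le_four [Fintype V]
    (hα : ∀ x y z, x ≠ y → x ≠ z → y ≠ z → G.Adj x y ∨ G.Adj x z ∨ G.Adj y z)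
    (hC : ¬ (SimpleGraph.cycleGraph 5).IsIndContained G)
    (hT : ∀ x y z, G.Adj x y → G.Adj x z → ¬ G.Adj y z) (s : V) : Fintype.card V ≤ 4 := by
  classical
  set N : Finset V := Finset.univ.filter fun v => G.Adj s v with hN
  set M : Finset V := Finset.univ.filter fun v => v ≠ s ∧ ¬ G.Adj s v with hM
  have hsum : Fintype.card V ≤ 1 + N.card + M.card := by
    have : (Finset.univ : Finset V) ⊆ {s} ∪ N ∪ M := by
      intro v _
      simp only [hN, hM, Finset.mem_union, Finset.mem_singleton, Finset.mem_filter,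
        Finset.mem_univ, true_and]
      tauto
    calc Fintype.card V ≤ ({s} ∪ N ∪ M).card := Finset.card_le_card this
      _ ≤ ({s} ∪ N).card + M.card := Finset.card_union_le _ _
      _ ≤ _ := by
        have := Finset.card_union_le {s} N
        simp only [Finset.card_singleton] at this
        omega
  have hN2 : N.card ≤ 2 := by
    by_contra! h
    obtain ⟨a, b, c, ha, hb, hc, hab, hac, hbc⟩ := Finset.two_lt_card_iff.1 h
    simp only [hN, Finset.mem_filter, Finset.mem_univ, true_and] at ha hb hc
    rcases hα a b c hab hac hbc with h | h | h
    exacts [hT _ _ _ ha hb h, hT _ _ _ ha hc h, hT _ _ _ hb hc h]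
  have hMadj : ∀ a ∈ M, ∀ b ∈ M, a ≠ b → G.Adj a b := by
    intro a ha b hb hab
    simp only [hM, Finset.mem_filter, Finset.mem_univ, true_and] at ha hb
    have := hα s a b ha.1.symm hb.1.symm hab
    tauto
  have hM2 : M.card ≤ 2 := by
    by_contra! h
    obtain ⟨a, b, c, ha, hb, hc, hab, hac, hbc⟩ := Finset.two_lt_card_iff.1 h
    exact hT a b c (hMadj a ha b hb hab) (hMadj a ha c hc hac) (hMadj b hb c hc hbc)
  by_contra! hcard
  obtain ⟨a, b, hab, hN'⟩ := Finset.card_eq_two.1 (by omega : N.card = 2)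
  obtain ⟨c, d, hcd, hM'⟩ := Finset.card_eq_two.1 (by omega : M.card = 2)
  have ha : G.Adj s a := (Finset.mem_filter.1 (hN' ▸ by simp : a ∈ N)).2
  have hb : G.Adj s b := (Finset.mem_filter.1 (hN' ▸ by simp : b ∈ N)).2
  have hcM : c ∈ M := hM' ▸ by simp
  have hdM : d ∈ M := hM' ▸ by simp
  have hc := (Finset.mem_filter.1 hcM).2
  have hd := (Finset.mem_filter.1 hdM).2
  have ecd := hMadj c hcM d hdM hcd
  have nab := hT s a b ha hb
  have hne : ∀ {p q : V}, G.Adj s p → ¬ G.Adj s q → p ≠ q := fun h h' e => h' (e ▸ h)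
  have habc := hα a b c hab (hne ha hc.2) (hne hb hc.2)
  have habd := hα a b d hab (hne ha hd.2) (hne hb hd.2)
  have nacd : G.Adj a c → ¬ G.Adj a d := fun h h' => hT a c d h h' ecd
  have nbcd : G.Adj b c → ¬ G.Adj b d := fun h h' => hT b c d h h' ecd
  by_cases hac : G.Adj a c
  · have nad := nacd hac
    have hbd : G.Adj b d := by tauto
    exact hC (cycleGraph_five_isIndContained ha hac ecd hbd.symm hb.symm hc.2 hd.2 nad nab
      fun h => nbcd h.symm hbd)
  · have hbc : G.Adj b c := by tauto
    have nbd := nbcd hbc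
    have had : G.Adj a d := by tauto
    exact hC (cycleGraph_five_isIndContained ha had ecd.symm hbc.symm hb.symm hd.2 hc.2 hac nab
      fun h => nbd h.symm)

theorem card_sub_two_le_productThrottling [Fintype V] [Nonempty V]
    (hα : ∀ x y z, x ≠ y → x ≠ z → y ≠ z → G.Adj x y ∨ G.Adj x z ∨ G.Adj y z)
    (hC : ¬ (SimpleGraph.cycleGraph 5).IsIndContained G) (hH : ¬ houseGraph.IsIndContained G) :
    ((Fintype.card V - 2 : ℕ) : ℕ∞) ≤ productThrottling G := by
  refine le_productThrottling fun S p hS hlt hp => ?_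
  have hp1 := pos_of_blue_eq_univ hlt hp
  have hcard := card_le_of_blue_eq_univ (ncard_forced_le_two hα hC hH) hp
  rcases Nat.lt_or_ge S.card 2 with hk | hk
  · obtain ⟨s, rfl⟩ := Finset.card_eq_one.1 (by have := hS.card_pos; omega : S.card = 1)
    rw [Finset.coe_singleton] at hp
    have := card_le_four hα hC (fun x y z => not_triangle_of_blue_singleton hp) s
    rw [Finset.card_singleton] at hcard ⊢
    omega
  · rw [tsub_le_iff_right]
    obtain ⟨k, hk⟩ := Nat.exists_eq_add_of_le hk
    obtain ⟨q, rfl⟩ := Nat.exists_eq_add_of_le hp1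
    rw [hk] at hcard ⊢
    nlinarith [Nat.zero_le (k * q)]

theorem card_sub_one_le_productThrottling [Fintype V] [Nonempty V]
    (hα : ∀ x y, x ≠ y → G.Adj x y) :
    ((Fintype.card V - 1 : ℕ) : ℕ∞) ≤ productThrottling G := by
  refine le_productThrottling fun S p hS hlt hp => ?_
  have hp1 := pos_of_blue_eq_univ hlt hp
  have hone : ∀ B : Set V, {w | ∃ v, Forces G B v w}.ncard ≤ 1 := by
    intro B
    rw [Set.ncard_le_one]
    rintro a ⟨x, hx⟩ b ⟨y, hy⟩
    by_contra hab
    have hr := WhiteReachable.of_adj hx.not_mem hy.not_mem (hα a b hab)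
    exact hx.not_adj (Ne.symm hab) hr.symm (hα x b fun h => hy.not_mem (h ▸ hx.1))
  have hcard := card_le_of_blue_eq_univ hone hp
  have hk := hS.card_pos
  rw [tsub_le_iff_right]
  obtain ⟨k, hk⟩ := Nat.exists_eq_add_of_le hk
  obtain ⟨q, rfl⟩ := Nat.exists_eq_add_of_le hp1
  rw [hk] at hcard ⊢
  nlinarith [Nat.zero_le (k * q)]

theorem indepNum_eq_two_iff [Fintype V] :
    G.indepNum = 2 ↔ (∃ x y, x ≠ y ∧ ¬ G.Adj x y) ∧
      ∀ x y z, x ≠ y → x ≠ z → y ≠ z → G.Adj x y ∨ G.Adj x z ∨ G.Adj y z := by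
  classical
  constructor
  · intro h
    constructor
    · obtain ⟨s, hs⟩ := G.exists_isNIndepSet_indepNum
      rw [h] at hs
      obtain ⟨x, y, hxy, rfl⟩ := Finset.card_eq_two.1 hs.card_eq
      exact ⟨x, y, hxy, hs.isIndepSet (by simp) (by simp) hxy⟩
    · intro x y z hxy hxz hyz
      by_contra! hcon
      have hI : G.IsIndepSet (({x, y, z} : Finset V) : Set V) := by
        intro a ha b hb hab
        simp only [Finset.coe_insert, Finset.coe_singleton, Set.mem_insert_iff,
          Set.mem_singleton_iff] at ha hb
        grind [G.adj_comm]
      have := hI.card_le_indepNum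
      rw [Finset.card_eq_three.2 ⟨x, y, z, hxy, hxz, hyz, rfl⟩, h] at this
      omega
  · rintro ⟨⟨x, y, hxy, nxy⟩, hα⟩
    apply le_antisymm
    · obtain ⟨s, hs⟩ := G.exists_isNIndepSet_indepNum
      by_contra! h
      rw [← hs.card_eq] at h
      obtain ⟨a, b, c, ha, hb, hc, hab, hac, hbc⟩ := Finset.two_lt_card_iff.1 h
      rcases hα a b c hab hac hbc with h | h | h
      exacts [hs.isIndepSet ha hb hab h, hs.isIndepSet ha hc hac h, hs.isIndepSet hb hc hbc h]
    · have hI : G.IsIndepSet (({x, y} : Finset V) : Set V) := by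
        intro a ha b hb hab
        simp only [Finset.coe_insert, Finset.coe_singleton, Set.mem_insert_iff,
          Set.mem_singleton_iff] at ha hb
        grind [G.adj_comm]
      have := hI.card_le_indepNum
      rwa [Finset.card_pair hxy] at this

end PSDThrottling

theorem mainTheorem5 {V : Type*} [Fintype V] (G : SimpleGraph V) (hG : G.Connected)
    (hn : 2 ≤ Fintype.card V) :
    PSDThrottling.productThrottling G = ((Fintype.card V - 2 : ℕ) : ℕ∞) ↔
      G.indepNum = 2 ∧
        ¬ (SimpleGraph.cycleGraph 5).IsIndContained G ∧
        ¬ PSDThrottling.houseGraph.IsIndContained G := by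
  have : Nontrivial V := Fintype.one_lt_card_iff_nontrivial.1 hn
  rw [PSDThrottling.indepNum_eq_two_iff]
  constructor
  · intro h
    have hnot : ¬ PSDThrottling.productThrottling G + 3 ≤ Fintype.card V := by
      rw [h]
      intro hle
      have : Fintype.card V - 2 + 3 ≤ Fintype.card V := by exact_mod_cast hle
      omega
    refine ⟨⟨?_, fun x y z hxy hxz hyz => ?_⟩,
      fun hC => hnot (PSDThrottling.productThrottling_add_three_le_of_cycleGraph_five hC),
      fun hH => hnot (PSDThrottling.productThrottling_add_three_le_of_houseGraph hH)⟩
    · by_contra! hα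
      have hle := PSDThrottling.card_sub_one_le_productThrottling hα
      rw [h, Nat.cast_le] at hle
      omega
    · by_contra! hcon
      exact hnot (PSDThrottling.productThrottling_add_three_le_of_indep hG.preconnected hxy hxz hyz
        hcon.1 hcon.2.1 hcon.2.2)
  · rintro ⟨⟨⟨x, y, hxy, nxy⟩, hα⟩, hC, hH⟩
    obtain ⟨v, hv⟩ := hG.preconnected.exists_adj_of_nontrivial x
    obtain ⟨v', hv'⟩ := hG.preconnected.exists_adj_of_nontrivial y
    exact le_antisymm
      (PSDThrottling.productThrottling_le_card_sub_two hxy nxy ⟨v, hv.symm⟩ ⟨v', hv'.symm⟩)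
      (PSDThrottling.card_sub_two_le_productThrottling hα hC hH)
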